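/- Let $B$ be a unital $C^*$-algebra with unit $\mathbf 1$, and for $b\in B$ put $\operatorname{Im}(b)=\frac{1}{2i}(b-b^*)$. Let $\mathbb H^{\pm}(B)=\{b\in B : \exists\,\varepsilon>0,\ \pm\operatorname{Im}(b)\ge\varepsilon\mathbf 1\}$ and, for $\gamma>0$, $\overline{\mathbb H^+_\gamma(B)}=\{b\in B:\operatorname{Im}(b)\ge\gamma\mathbf 1\}$. Let $\mathcal L(B)$ be the space of bounded linear operators on $B$ with the operator norm, and let $\mathcal P_2(B)\subseteq\mathcal L(B)$ be the set of all $2$-positive linear maps $\eta:B\to B$ (i.e. $\eta$ is positive and its entrywise amplification to $M_2(B)$ is positive), with the norm topology. For each $\eta\in\mathcal P_2(B)$ there is a unique function $G_\eta:\mathbb H^+(B)\to\mathbb H^-(B)$ with $$b\,G_\eta(b)=\mathbf 1+\eta(G_\eta(b))\,G_\eta(b)\qquad\text{for all } b\in\mathbb H^+(B),$$ and $G_\eta$ is (complex) Fréchet differentiable on the open set $\mathbb H^+(B)$, with Fréchet derivative $DG_\eta:\mathbb H^+(B)\to\mathcal L(B)$. Moreover: 1. For every $\gamma>0$, the family of maps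 $\mathcal P_2(B)\ni\eta\mapsto G_\eta(b)$, indexed by $b\in\overline{\mathbb H^+_\gamma(B)}$, is equicontinuous, i.e. for every $\eta_0\in\mathcal P_2(B)$ $$\lim_{\eta\to\eta_0}\ \sup_{b\in\overline{\mathbb H^+_\gamma(B)}}\|G_\eta(b)-G_{\eta_0}(b)\|=0 .$$ In particular, $(\eta,b)\mapsto G_\eta(b)$ is continuous on $\mathcal P_2(B)\times\mathbb H^+(B)$ with the product topology. 2. For every $\gamma>0$, the family of maps $\mathcal P_2(B)\ni\eta\mapsto (DG_\eta)(b)\in\mathcal L(B)$, indexed by $b\in\overline{\mathbb H^+_\gamma(B)}$, is equicontinuous, i.e. for every $\eta_0\in\mathcal P_2(B)$ $$\lim_{\eta\to\eta_0}\ \sup_{b\in\overline{\mathbb H^+_\gamma(B)}}\|(DG_\eta)(b)-(DG_{\eta_0})(b)\|=0 .$$ In particular, $(\eta,b)\mapsto (DG_\eta)(b)$ is continuous from $\mathcal P_2(B)\times\mathbb H^+(B)$ to $\mathcal L(B)$. -/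

import Mathlib

open Topology Filter
open scoped ComplexStarModule

/-- The operator upper half-plane: all `b` with `Im b ≥ ε 1` for some `ε > 0`, where
`ℑ b = (b - b⋆) / (2 i)`. -/
def opUpperHalf (B : Type*) [CStarAlgebra B] [PartialOrder B] : Set B :=
  {b | ∃ ε : ℝ, 0 < ε ∧ ε • (1 : B) ≤ (ℑ b : B)}

/-- The operator lower half-plane: all `b` with `-Im b ≥ ε 1` for some `ε > 0`. -/
def opLowerHalf (B : Type*) [CStarAlgebra B] [PartialOrder B] : Set B :=
  {b | ∃ ε : ℝ, 0 < ε ∧ ε • (1 : B) ≤ -(ℑ b : B)}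

/-- The closed half-plane of all `b` with `Im b ≥ γ 1`. -/
def opClosedUpperHalf (B : Type*) [CStarAlgebra B] [PartialOrder B] (γ : ℝ) : Set B :=
  {b | γ • (1 : B) ≤ (ℑ b : B)}

/-- The `k`-positive linear maps `B → B`: those positive maps whose entrywise amplification to
the C⋆-algebra of `k × k` matrices over `B` is positive too. Positive linear maps between unital
C⋆-algebras are automatically bounded, so this is a subset of the space of bounded operators,
from which it inherits the norm topology. -/
def kPositiveMaps (k : ℕ) (B : Type*) [CStarAlgebra B] [PartialOrder B] [StarOrderedRing B] :
    Set (B →L[ℂ] B) :=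
  {η | (∀ b : B, 0 ≤ b → 0 ≤ η b) ∧
    ∀ M : CStarMatrix (Fin k) (Fin k) B, 0 ≤ M → 0 ≤ M.map η}

/-- `F` restricts to a map from the upper to the lower half-plane which solves the Dyson equation
`b F(b) = 1 + η(F(b)) F(b)` for all `b` in the upper half-plane. -/
def IsDysonSolution {B : Type*} [CStarAlgebra B] [PartialOrder B] (η : B →L[ℂ] B) (F : B → B) :
    Prop :=
  ∀ b ∈ opUpperHalf B, F b ∈ opLowerHalf B ∧ b * F b = 1 + η (F b) * F b

open Classical in
/-- The solution `G_η` of the Dyson equation. Only its values on the upper half-plane (an open set)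
are meaningful. -/
noncomputable def dysonSolution {B : Type*} [CStarAlgebra B] [PartialOrder B] (η : B →L[ℂ] B) :
    B → B :=
  if h : ∃ F : B → B, IsDysonSolution η F then h.choose else 0

/-! Put `g = (b - η w)⁻¹` with `Im b ≥ γ` and `0 ≤ -Im w ≤ γ⁻¹`. Then `-Im g = g Im(b - η w) g⋆ = g⋆
Im(b - η w) g`, and `Im(b - η w) = Im b + η(-Im w)`. The positive term `Im b` makes `η(-Im w)` at
most `q · Im(b - η w)`, where `q = K / (γ² + K) < 1` for `‖η‖ ≤ K`; the rate does not depend on `b`.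

Measure `x` by the least `c` for which the block matrix with diagonal `c(-Im w₁)`, `c(-Im w₂)` and
corner `x` is positive. 2-positivity lets `η` act on this matrix, and conjugation by `g₁`, `g₂`
shows that `x ↦ g₁ η(x) g₂` contracts this gauge by `q` (`IsDysonStep.blockNonneg`). By the
resolvent identity, differences of iterates evolve under such maps, so the iteration `w ↦ (b - η
w)⁻¹` converges to a solution.

At solutions, the same contraction bounds `(1 - S)⁻¹` for `S x = g₁ η(x) g₂`, uniformly in `b`.
Since `(1 - S)(g₁ - g₂) = g₁ (b₂ - b₁) g₂`, this gives uniqueness, a Lipschitz bound in `b` and the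
derivative. A change of `η` is absorbed into a change of `b` (`IsDysonStep.change_map`). -/

/-! ### Positive 2 × 2 block matrices -/

section Block

variable {B : Type*} [CStarAlgebra B] [PartialOrder B] [StarOrderedRing B]

/-- Positivity of the self-adjoint `2 × 2` block matrix with diagonal `a`, `d` and upper right
entry `z`. For positive `a`, `d` it says that `z = a ^ (1/2) * k * d ^ (1/2)` with a
contraction `k`, up to invertibility. -/
def BlockNonneg (a z d : B) : Prop :=
  0 ≤ (CStarMatrix.ofMatrix !![a, z; star z, d] : CStarMatrix (Fin 2) (Fin 2) B)

lemma blockNonneg_diag {a d : B} (ha : 0 ≤ a) (hd : 0 ≤ d) : BlockNonneg a 0 d := by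
  obtain ⟨x, rfl⟩ := CStarAlgebra.nonneg_iff_eq_star_mul_self.mp ha
  obtain ⟨y, rfl⟩ := CStarAlgebra.nonneg_iff_eq_star_mul_self.mp hd
  have h := star_mul_self_nonneg
    (CStarMatrix.ofMatrix !![x, 0; 0, y] : CStarMatrix (Fin 2) (Fin 2) B)
  unfold BlockNonneg
  convert h using 1
  ext i j
  fin_cases i <;> fin_cases j <;>
    simp [CStarMatrix.mul_apply, CStarMatrix.star_apply, Fin.sum_univ_two]

namespace BlockNonneg

lemma add {a z d a' z' d' : B} (h : BlockNonneg a z d) (h' : BlockNonneg a' z' d') :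
    BlockNonneg (a + a') (z + z') (d + d') := by
  have := add_nonneg h h'
  unfold BlockNonneg
  convert this using 1
  ext i j
  fin_cases i <;> fin_cases j <;> simp

lemma mono {a z d a' d' : B} (h : BlockNonneg a z d) (ha : a ≤ a') (hd : d ≤ d') :
    BlockNonneg a' z d' := by
  simpa using h.add (blockNonneg_diag (sub_nonneg.mpr ha) (sub_nonneg.mpr hd))

lemma conj {a z d : B} (h : BlockNonneg a z d) (g k : B) :
    BlockNonneg (g * a * star g) (g * z * k) (star k * d * k) := by
  have := star_right_conjugate_nonneg h
    (CStarMatrix.ofMatrix !![g, 0; 0, star k] : CStarMatrix (Fin 2) (Fin 2) B)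
  unfold BlockNonneg
  convert this using 1
  ext i j
  fin_cases i <;> fin_cases j <;>
    simp [CStarMatrix.mul_apply, CStarMatrix.star_apply, Fin.sum_univ_two, mul_assoc]

lemma smul {a z d : B} (h : BlockNonneg a z d) {c : ℝ} (hc : 0 ≤ c) :
    BlockNonneg (c • a) (c • z) (c • d) := by
  have h1 := h.conj (algebraMap ℝ B (√c)) (algebraMap ℝ B (√c))
  have h2 : ∀ x : B, algebraMap ℝ B (√c) * x * algebraMap ℝ B (√c) = c • x := fun x => by
    rw [← Algebra.commutes, ← mul_assoc, ← map_mul, Real.mul_self_sqrt hc, ← Algebra.smul_def]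
  have h3 : star (algebraMap ℝ B (√c)) = algebraMap ℝ B (√c) := by
    rw [← algebraMap_star_comm]; simp
  simpa only [h2, h3] using h1

lemma entry_nonneg {M : CStarMatrix (Fin 2) (Fin 2) B} (h : 0 ≤ M) : 0 ≤ M 0 0 := by
  refine AddSubmonoid.closure_induction ?_ le_rfl (fun M N _ _ hM hN => add_nonneg hM hN)
    (StarOrderedRing.nonneg_iff.mp h)
  rintro _ ⟨N, rfl⟩
  simp only [CStarMatrix.mul_apply, CStarMatrix.star_apply]
  exact Finset.sum_nonneg fun i _ => star_mul_self_nonneg _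

lemma quadratic_nonneg {a z d : B} (h : BlockNonneg a z d) (x y : B) :
    0 ≤ star x * a * x + star x * z * y + star y * star z * x + star y * d * y := by
  have := entry_nonneg (star_left_conjugate_nonneg h
    (CStarMatrix.ofMatrix !![x, 0; y, 0] : CStarMatrix (Fin 2) (Fin 2) B))
  convert this using 1
  simp [CStarMatrix.mul_apply, CStarMatrix.star_apply, Fin.sum_univ_two, mul_assoc, add_mul]
  abel

/-- With `e` on the diagonal, the quadratic form at the vector `(z, -e)` is `e³ - e z⋆z`. Dividing
by `e` needs `e > 0`, so `c` is approached from above. -/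
lemma norm_le {z : B} {c : ℝ} (hc : 0 ≤ c) (h : BlockNonneg (c • 1) z (c • 1)) : ‖z‖ ≤ c := by
  have key : ∀ e : ℝ, 0 < e → c ≤ e → ‖z‖ ≤ e := fun e he hce => by
    have hm : (c • 1 : B) ≤ e • 1 := smul_le_smul_of_nonneg_right hce zero_le_one
    have h1 := (h.mono hm hm).quadratic_nonneg z (-(e • 1))
    have h2 : 0 ≤ (e ^ 3) • (1 : B) - e • (star z * z) := by
      convert h1 using 1
      simp [mul_assoc, smul_smul, pow_succ]
      abel
    have h3 : 0 ≤ e⁻¹ • ((e ^ 3) • (1 : B) - e • (star z * z)) :=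
      smul_nonneg (by positivity) h2
    rw [smul_sub, smul_smul, smul_smul, inv_mul_cancel₀ he.ne', one_smul, sub_nonneg,
      show e⁻¹ * e ^ 3 = e ^ 2 by field_simp, ← Algebra.algebraMap_eq_smul_one,
      ← CStarAlgebra.norm_le_iff_le_algebraMap _ (by positivity), CStarRing.norm_star_mul_self]
      at h3
    exact le_of_sq_le_sq (by nlinarith) he.le
  exact le_of_forall_pos_le_add fun e he => key _ (by positivity) (by linarith)

/-- The matrix with rows `(1, k)`, `(k⋆, k⋆k)` is `N⋆N` for `N` with first row `(1, k)` and zero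
second row; then `k⋆k ≤ 1`. -/
lemma of_norm_le_one {k : B} (hk : ‖k‖ ≤ 1) : BlockNonneg 1 k 1 := by
  have h1 : 0 ≤ 1 - star k * k := by
    rw [sub_nonneg, ← map_one (algebraMap ℝ B),
      ← CStarAlgebra.norm_le_iff_le_algebraMap _ (by positivity), CStarRing.norm_star_mul_self]
    nlinarith [norm_nonneg k]
  have h2 : BlockNonneg 1 k (star k * k) := by
    have h := star_mul_self_nonneg
      (CStarMatrix.ofMatrix !![1, k; 0, 0] : CStarMatrix (Fin 2) (Fin 2) B)
    unfold BlockNonneg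
    convert h using 1
    ext i j
    fin_cases i <;> fin_cases j <;>
      simp [CStarMatrix.mul_apply, CStarMatrix.star_apply, Fin.sum_univ_two]
  simpa using h2.mono le_rfl (sub_nonneg.mp h1)

lemma of_norm_le {a z d : B} {c : ℝ} (hz : ‖z‖ ≤ c) (ha : c • 1 ≤ a) (hd : c • 1 ≤ d) :
    BlockNonneg a z d := by
  refine BlockNonneg.mono ?_ ha hd
  have hc : 0 ≤ c := (norm_nonneg z).trans hz
  rcases hc.eq_or_lt with rfl | hc'
  · obtain rfl : z = 0 := by simpa using hz
    simpa using blockNonneg_diag (le_refl (0 : B)) le_rfl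
  · have h : ‖c⁻¹ • z‖ ≤ 1 := by
      rw [norm_smul, Real.norm_of_nonneg (by positivity), inv_mul_le_one₀ hc']
      exact hz
    simpa [smul_smul, hc'.ne'] using (of_norm_le_one h).smul hc

end BlockNonneg

lemma map_star_of_nonneg {η : B →L[ℂ] B} (hη : ∀ b : B, 0 ≤ b → 0 ≤ η b) (b : B) :
    η (star b) = star (η b) :=
  map_star (PositiveLinearMap.mk₀ (η : B →ₗ[ℂ] B) hη) b

lemma map_mono_of_nonneg {η : B →L[ℂ] B} (hη : ∀ b : B, 0 ≤ b → 0 ≤ η b) {a b : B}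
    (h : a ≤ b) : η a ≤ η b := by
  simpa using hη _ (sub_nonneg.mpr h)

lemma imaginaryPart_map_of_nonneg {η : B →L[ℂ] B} (hη : ∀ b : B, 0 ≤ b → 0 ≤ η b) (b : B) :
    (ℑ (η b) : B) = η (ℑ b : B) := by
  have h := (η.restrictScalars ℝ).map_smul (2⁻¹ : ℝ) (b - star b)
  simp only [ContinuousLinearMap.coe_restrictScalars'] at h
  simp only [imaginaryPart_apply_coe, map_smul, map_sub, h, map_star_of_nonneg hη]

/-- The only use of the amplification to `M₂(B)`; everything else needs only positivity of `η`. -/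
lemma BlockNonneg.map {η : B →L[ℂ] B} (hη : η ∈ kPositiveMaps 2 B) {a z d : B}
    (h : BlockNonneg a z d) : BlockNonneg (η a) (η z) (η d) := by
  have := hη.2 _ h
  unfold BlockNonneg
  convert this using 1
  ext i j
  fin_cases i <;> fin_cases j <;> simp [map_star_of_nonneg hη.1]

end Block

/-! ### Inverses of elements of the upper half-plane -/

section HalfPlane

variable {B : Type*} [CStarAlgebra B]

lemma imaginaryPart_conj_right {a g : B} (h : a * g = 1) :
    star g * (ℑ a : B) * g = -(ℑ g : B) := by
  have h' : star g * star a = 1 := by rw [← star_mul, h, star_one]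
  simp only [imaginaryPart_apply_coe, mul_smul_comm, smul_mul_assoc, mul_sub, sub_mul, h', one_mul,
    mul_assoc, h, mul_one, ← smul_neg, neg_sub]

lemma imaginaryPart_conj_left {a g : B} (h : g * a = 1) :
    g * (ℑ a : B) * star g = -(ℑ g : B) := by
  have h' : star a * star g = 1 := by rw [← star_mul, h, star_one]
  simp only [imaginaryPart_apply_coe, mul_smul_comm, smul_mul_assoc, mul_sub, sub_mul, h, one_mul,
    mul_assoc, h', mul_one, ← smul_neg, neg_sub]

variable [PartialOrder B] [StarOrderedRing B]

lemma CStarAlgebra.norm_one_le (B : Type*) [CStarAlgebra B] : ‖(1 : B)‖ ≤ 1 := by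
  rcases subsingleton_or_nontrivial B with h | h
  · simp [Subsingleton.elim (1 : B) 0]
  · exact CStarRing.norm_one.le

lemma le_smul_one_of_norm_le {a : B} (ha : IsSelfAdjoint a) {c : ℝ} (hc : ‖a‖ ≤ c) :
    a ≤ c • (1 : B) := by
  refine (IsSelfAdjoint.le_algebraMap_norm_self ha).trans ?_
  rw [Algebra.algebraMap_eq_smul_one]
  exact smul_le_smul_of_nonneg_right hc zero_le_one

/-- For large `t`, `(a - it)⋆(a - it) = a⋆a - 2t Im a + t² ≤ t² - 1`, so `‖a - it‖ < t` and `a` is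
invertible by a Neumann series around `it`. -/
lemma isUnit_of_le_imaginaryPart {a : B} {γ : ℝ} (hγ : 0 < γ) (h : γ • (1 : B) ≤ (ℑ a : B)) :
    IsUnit a := by
  -- The quotient gives `tγ ≥ ‖a‖² + 1`; the final `+ 1` ensures `t² - 1 ≥ 0`.
  set t : ℝ := (‖a‖ ^ 2 + 1) / γ + 1 with ht
  have htpos : 0 < t := by positivity
  have htγ : ‖a‖ ^ 2 + 1 ≤ t * γ := by
    rw [ht, add_mul, div_mul_cancel₀ _ hγ.ne']
    linarith
  have ht1 : 1 ≤ t := by rw [ht]; linarith [show 0 ≤ (‖a‖ ^ 2 + 1) / γ by positivity]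
  set c : ℂ := (t : ℂ) * Complex.I with hc
  have hc0 : c ≠ 0 := by simp [hc, htpos.ne']
  have hcn : ‖c‖ = t := by simp [hc, abs_of_pos htpos]
  have key : star (a - c • 1) * (a - c • 1)
      = star a * a - (2 * t) • (ℑ a : B) + (t ^ 2) • 1 := by
    have e1 : (2 * t) • (ℑ a : B) = -(c • (a - star a)) := by
      rw [imaginaryPart_apply_coe, ← Complex.coe_smul, ← Complex.coe_smul, smul_smul, smul_smul,
        ← neg_smul]
      congr 1
      simp [hc]
      ring
    have e2 : (t ^ 2) • (1 : B) = (-c * c) • 1 := by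
      rw [← Complex.coe_smul]
      congr 1
      simp only [hc, Complex.ofReal_pow]
      linear_combination ((t : ℂ) ^ 2) * Complex.I_mul_I
    have e3 : star c = -c := by simp [hc]
    rw [e1, e2, star_sub, star_smul, e3, star_one, mul_smul (-c)]
    simp only [sub_mul, mul_sub, smul_mul_assoc, one_mul, mul_smul_comm, mul_one, smul_sub,
      neg_smul, neg_mul, smul_neg]
    abel
  have hle : star (a - c • 1) * (a - c • 1) ≤ (t ^ 2 - 1) • (1 : B) := by
    have h1 : star a * a ≤ (‖a‖ ^ 2) • (1 : B) :=
      le_smul_one_of_norm_le (.star_mul_self a) (by rw [CStarRing.norm_star_mul_self, sq])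
    have h2 : (2 * t) • (γ • (1 : B)) ≤ (2 * t) • (ℑ a : B) :=
      smul_le_smul_of_nonneg_left h (by positivity)
    have h3 : (‖a‖ ^ 2 - 2 * t * γ + t ^ 2) • (1 : B) ≤ (t ^ 2 - 1) • (1 : B) :=
      smul_le_smul_of_nonneg_right (by nlinarith [sq_nonneg ‖a‖]) zero_le_one
    rw [key]
    refine le_trans ?_ h3
    rw [add_smul, sub_smul, mul_smul (2 * t) γ]
    gcongr
  have hlt : ‖1 - c⁻¹ • a‖ < 1 := by
    rcases subsingleton_or_nontrivial B with hB | hB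
    · simp [Subsingleton.elim (1 - c⁻¹ • a) 0]
    have h1 : ‖star (a - c • 1) * (a - c • 1)‖ ≤ ‖(t ^ 2 - 1) • (1 : B)‖ :=
      CStarAlgebra.norm_le_norm_of_nonneg_of_le (star_mul_self_nonneg _) hle
    have h0 : 0 ≤ t ^ 2 - 1 := by nlinarith
    rw [CStarRing.norm_star_mul_self, norm_smul, CStarRing.norm_one, mul_one,
      Real.norm_of_nonneg h0] at h1
    have h2 : ‖a - c • 1‖ < t := by
      by_contra! hcon
      nlinarith
    have h3 : 1 - c⁻¹ • a = -(c⁻¹ • (a - c • 1)) := by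
      rw [smul_sub, smul_smul, inv_mul_cancel₀ hc0, one_smul, neg_sub]
    rw [h3, norm_neg, norm_smul, norm_inv, hcn, inv_mul_lt_one₀ htpos]
    exact h2
  have hu : IsUnit (c⁻¹ • a) := by
    simpa using isUnit_one_sub_of_norm_lt_one hlt
  simpa [smul_smul, hc0] using hu.smul (Units.mk0 c hc0)

/-- Conjugation by `g` gives `γ g⋆g ≤ -Im g`, hence `γ‖g‖² ≤ ‖g‖`. -/
lemma norm_le_inv_of_le_imaginaryPart {a g : B} {γ : ℝ} (hγ : 0 < γ)
    (h : γ • (1 : B) ≤ (ℑ a : B)) (hg : a * g = 1) : ‖g‖ ≤ γ⁻¹ := by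
  have h1 : γ • (star g * g) ≤ -(ℑ g : B) := by
    rw [← imaginaryPart_conj_right hg]
    simpa using star_left_conjugate_le_conjugate h g
  have h2 := CStarAlgebra.norm_le_norm_of_nonneg_of_le
    (smul_nonneg hγ.le (star_mul_self_nonneg g)) h1
  rw [norm_smul, CStarRing.norm_star_mul_self, norm_neg, Real.norm_of_nonneg hγ.le] at h2
  have h3 : ‖(ℑ g : B)‖ ≤ ‖g‖ := imaginaryPart.norm_le g
  rcases (norm_nonneg g).eq_or_lt with h0 | h0
  · rw [← h0]; positivity
  · rw [le_inv_comm₀ h0 hγ, ← one_div, le_div_iff₀ h0]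
    nlinarith

/-- Here `-Im g ≥ γ g g⋆`, and `1 = g a a⋆ g⋆ ≤ (‖a‖² + 1) g g⋆` bounds `g g⋆` from below. -/
lemma inverse_mem_opLowerHalf {a g : B} {γ : ℝ} (hγ : 0 < γ) (h : γ • (1 : B) ≤ (ℑ a : B))
    (hg : g * a = 1) : g ∈ opLowerHalf B := by
  refine ⟨γ * (‖a‖ ^ 2 + 1)⁻¹, by positivity, ?_⟩
  rw [← imaginaryPart_conj_left hg]
  have h1 : γ • (g * star g) ≤ g * (ℑ a : B) * star g := by
    simpa using star_right_conjugate_le_conjugate h g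
  have h2 : (1 : B) ≤ (‖a‖ ^ 2 + 1) • (g * star g) := by
    have h3 : a * star a ≤ (‖a‖ ^ 2 + 1) • (1 : B) :=
      le_smul_one_of_norm_le (.mul_star_self a)
        (by rw [CStarRing.norm_self_mul_star, sq]; linarith)
    have h4 := star_right_conjugate_le_conjugate h3 g
    rwa [show g * (a * star a) * star g = (g * a) * star (g * a) by simp [mul_assoc], hg, star_one,
      one_mul, mul_smul_comm, mul_one, smul_mul_assoc] at h4
  refine le_trans ?_ h1
  rw [mul_smul]
  refine smul_le_smul_of_nonneg_left ?_ hγ.le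
  have h5 := smul_le_smul_of_nonneg_left h2 (show 0 ≤ (‖a‖ ^ 2 + 1)⁻¹ by positivity)
  rwa [smul_smul, inv_mul_cancel₀ (by positivity), one_smul] at h5

end HalfPlane

/-! ### Contraction in one step of the Dyson iteration -/

section Step

variable {B : Type*} [CStarAlgebra B] [PartialOrder B] [StarOrderedRing B]

/-- `g = (b - η(w))⁻¹`, where `Im b ≥ γ` and `0 ≤ -Im w ≤ γ⁻¹`. For `w = g` this says that `g`
solves the Dyson equation at `b`. -/
structure IsDysonStep (η : B →L[ℂ] B) (γ : ℝ) (b w g : B) : Prop where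
  le_imaginaryPart : γ • (1 : B) ≤ (ℑ b : B)
  nonneg : 0 ≤ -(ℑ w : B)
  le : -(ℑ w : B) ≤ γ⁻¹ • 1
  mul_right : (b - η w) * g = 1
  mul_left : g * (b - η w) = 1

lemma imaginaryPart_sub_map {η : B →L[ℂ] B} (hη : η ∈ kPositiveMaps 2 B) (b w : B) :
    (ℑ (b - η w) : B) = ℑ b + η (-(ℑ w : B)) := by
  rw [map_sub, AddSubgroupClass.coe_sub, imaginaryPart_map_of_nonneg hη.1, map_neg, sub_eq_add_neg]

lemma le_imaginaryPart_sub_map {η : B →L[ℂ] B} (hη : η ∈ kPositiveMaps 2 B) {γ : ℝ} {b w : B}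
    (hb : γ • (1 : B) ≤ (ℑ b : B)) (hw : 0 ≤ -(ℑ w : B)) :
    γ • (1 : B) ≤ (ℑ (b - η w) : B) := by
  rw [imaginaryPart_sub_map hη]
  exact le_add_of_le_of_nonneg hb (hη.1 _ hw)

lemma neg_imaginaryPart_le {g : B} {c : ℝ} (h : ‖g‖ ≤ c) : -(ℑ g : B) ≤ c • 1 :=
  le_smul_one_of_norm_le (ℑ g).2.neg (by
    rw [norm_neg]
    exact (imaginaryPart.norm_le g).trans h)

/-- The contraction rate of the Dyson iteration. -/
noncomputable def dysonRate (K γ : ℝ) : ℝ := K / (γ ^ 2 + K)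

lemma dysonRate_nonneg {K γ : ℝ} (hγ : 0 < γ) (hK : 0 ≤ K) : 0 ≤ dysonRate K γ := by
  unfold dysonRate; positivity

lemma dysonRate_lt_one {K γ : ℝ} (hγ : 0 < γ) (hK : 0 ≤ K) : dysonRate K γ < 1 := by
  unfold dysonRate
  rw [div_lt_one (by positivity)]
  nlinarith [pow_pos hγ 2]

/-- With `q` the rate, `1 - q = γ² / (γ² + K)`. Bounding only the fraction `1 - q` of `η(-Im w)` by
`(K / γ²) Im b` gives `q Im b`, since `(1 - q) K / γ² = q`. -/
lemma map_le_dysonRate_smul {η : B →L[ℂ] B} (hη : η ∈ kPositiveMaps 2 B) {γ K : ℝ} (hγ : 0 < γ)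
    (hK : ‖η‖ ≤ K) {b w : B} (hb : γ • (1 : B) ≤ (ℑ b : B)) (hw : -(ℑ w : B) ≤ γ⁻¹ • 1) :
    η (-(ℑ w : B)) ≤ dysonRate K γ • (ℑ (b - η w) : B) := by
  have hK0 : 0 ≤ K := (norm_nonneg η).trans hK
  have h1 : η 1 ≤ K • (1 : B) := by
    refine le_smul_one_of_norm_le (.of_nonneg (hη.1 1 zero_le_one)) ?_
    calc ‖η 1‖ ≤ ‖η‖ * ‖(1 : B)‖ := η.le_opNorm 1
      _ ≤ K * 1 := by gcongr; exact CStarAlgebra.norm_one_le B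
      _ = K := mul_one K
  have h2 : η (-(ℑ w : B)) ≤ (K / γ ^ 2) • (ℑ b : B) := by
    calc η (-(ℑ w : B)) ≤ η (γ⁻¹ • 1) := map_mono_of_nonneg hη.1 hw
      _ = γ⁻¹ • η 1 := η.map_smul_of_tower _ _
      _ ≤ γ⁻¹ • K • (1 : B) := smul_le_smul_of_nonneg_left h1 (by positivity)
      _ = (K / γ ^ 2) • γ • (1 : B) := by
        rw [smul_smul, smul_smul]
        congr 1
        field_simp
      _ ≤ _ := smul_le_smul_of_nonneg_left hb (by positivity)
  have hq : dysonRate K γ + γ ^ 2 / (γ ^ 2 + K) = 1 := by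
    unfold dysonRate
    field_simp
    ring
  rw [imaginaryPart_sub_map hη, smul_add]
  calc η (-(ℑ w : B))
      = (γ ^ 2 / (γ ^ 2 + K)) • η (-(ℑ w : B)) + dysonRate K γ • η (-(ℑ w : B)) := by
        rw [← add_smul, add_comm, hq, one_smul]
    _ ≤ (γ ^ 2 / (γ ^ 2 + K)) • (K / γ ^ 2) • (ℑ b : B) + dysonRate K γ • η (-(ℑ w : B)) := by
        gcongr
    _ = _ := by
        rw [smul_smul]
        congr 2
        unfold dysonRate
        field_simp

namespace IsDysonStep

variable {η : B →L[ℂ] B} {γ : ℝ} {b w g : B}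

lemma norm_le (h : IsDysonStep η γ b w g) (hη : η ∈ kPositiveMaps 2 B) (hγ : 0 < γ) :
    ‖g‖ ≤ γ⁻¹ :=
  norm_le_inv_of_le_imaginaryPart hγ
    (le_imaginaryPart_sub_map hη h.le_imaginaryPart h.nonneg) h.mul_right

lemma out_le (h : IsDysonStep η γ b w g) (hη : η ∈ kPositiveMaps 2 B) (hγ : 0 < γ) :
    -(ℑ g : B) ≤ γ⁻¹ • 1 :=
  neg_imaginaryPart_le (h.norm_le hη hγ)

lemma mem_opLowerHalf (h : IsDysonStep η γ b w g) (hη : η ∈ kPositiveMaps 2 B) (hγ : 0 < γ) :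
    g ∈ opLowerHalf B :=
  inverse_mem_opLowerHalf hγ (le_imaginaryPart_sub_map hη h.le_imaginaryPart h.nonneg) h.mul_left

lemma out_nonneg (h : IsDysonStep η γ b w g) (hη : η ∈ kPositiveMaps 2 B) (hγ : 0 < γ) :
    0 ≤ -(ℑ g : B) := by
  obtain ⟨ε, hε, h'⟩ := h.mem_opLowerHalf hη hγ
  exact (smul_nonneg hε.le zero_le_one).trans h'

lemma ofInverse (hη : η ∈ kPositiveMaps 2 B) (hγ : 0 < γ) (hb : γ • (1 : B) ≤ (ℑ b : B))
    (hw : 0 ≤ -(ℑ w : B)) (hw' : -(ℑ w : B) ≤ γ⁻¹ • 1) :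
    IsDysonStep η γ b w (Ring.inverse (b - η w)) := by
  have hu := isUnit_of_le_imaginaryPart hγ (le_imaginaryPart_sub_map hη hb hw)
  exact ⟨hb, hw, hw', Ring.mul_inverse_cancel _ hu, Ring.inverse_mul_cancel _ hu⟩

/-- Schwarz-type bounds contract under `x ↦ g₁ η(x) g₂`. -/
lemma blockNonneg {K : ℝ} {b₁ w₁ g₁ b₂ w₂ g₂ : B} (h₁ : IsDysonStep η γ b₁ w₁ g₁)
    (h₂ : IsDysonStep η γ b₂ w₂ g₂) (hη : η ∈ kPositiveMaps 2 B) (hγ : 0 < γ) (hK : ‖η‖ ≤ K)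
    {c : ℝ} (hc : 0 ≤ c) {x : B} (hx : BlockNonneg (c • -(ℑ w₁ : B)) x (c • -(ℑ w₂ : B))) :
    BlockNonneg ((c * dysonRate K γ) • -(ℑ g₁ : B)) (g₁ * η x * g₂)
      ((c * dysonRate K γ) • -(ℑ g₂ : B)) := by
  have h3 := hx.map hη
  rw [η.map_smul_of_tower, η.map_smul_of_tower] at h3
  have h4 := (h3.mono
    (smul_le_smul_of_nonneg_left
      (map_le_dysonRate_smul hη hγ hK h₁.le_imaginaryPart h₁.le) hc)
    (smul_le_smul_of_nonneg_left
      (map_le_dysonRate_smul hη hγ hK h₂.le_imaginaryPart h₂.le) hc)).conj g₁ g₂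
  simpa only [smul_smul, mul_smul_comm, smul_mul_assoc, imaginaryPart_conj_left h₁.mul_left,
    imaginaryPart_conj_right h₂.mul_right] using h4

lemma norm_le_of_blockNonneg {b₁ w₁ g₁ b₂ w₂ g₂ : B} (h₁ : IsDysonStep η γ b₁ w₁ g₁)
    (h₂ : IsDysonStep η γ b₂ w₂ g₂) (hγ : 0 < γ)
    {c : ℝ} (hc : 0 ≤ c) {x : B} (hx : BlockNonneg (c • -(ℑ w₁ : B)) x (c • -(ℑ w₂ : B))) :
    ‖x‖ ≤ c * γ⁻¹ := by
  refine BlockNonneg.norm_le (by positivity) (hx.mono ?_ ?_) <;> rw [mul_smul]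
  · exact smul_le_smul_of_nonneg_left h₁.le hc
  · exact smul_le_smul_of_nonneg_left h₂.le hc

end IsDysonStep

/-! ### Existence by iteration -/

section Existence

variable {η : B →L[ℂ] B} {γ : ℝ}

lemma exists_isDysonStep_self (hη : η ∈ kPositiveMaps 2 B) (hγ : 0 < γ) {b : B}
    (hb : γ • (1 : B) ≤ (ℑ b : B)) : ∃ g, IsDysonStep η γ b g g := by
  set h : B → B := fun w => Ring.inverse (b - η w) with hh
  let S : Set B := {w | 0 ≤ -(ℑ w : B) ∧ -(ℑ w : B) ≤ γ⁻¹ • 1}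
  have hstep : ∀ w ∈ S, IsDysonStep η γ b w (h w) := fun w hw => .ofInverse hη hγ hb hw.1 hw.2
  have hmaps : ∀ w ∈ S, h w ∈ S := fun w hw =>
    ⟨(hstep w hw).out_nonneg hη hγ, (hstep w hw).out_le hη hγ⟩
  set w₀ : B := (-(γ⁻¹ : ℝ) * Complex.I : ℂ) • 1 with hw₀
  have hIw₀ : -(ℑ w₀ : B) = γ⁻¹ • 1 := by
    rw [hw₀, imaginaryPart_smul]
    simp
  have hw₀S : w₀ ∈ S := ⟨by rw [hIw₀]; exact smul_nonneg (by positivity) zero_le_one, hIw₀.le⟩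
  have hS : ∀ n, h^[n] w₀ ∈ S := fun n => by
    induction n with
    | zero => exact hw₀S
    | succ n ih => rw [Function.iterate_succ_apply']; exact hmaps _ ih
  set q := dysonRate ‖η‖ γ
  have hq0 : 0 ≤ q := dysonRate_nonneg hγ (norm_nonneg η)
  have hq1 : q < 1 := dysonRate_lt_one hγ (norm_nonneg η)
  -- Both `-Im w₀ = γ⁻¹` and `-Im (h w₀) ≥ ε` are bounded below, so a large `c` dominates the first
  -- difference, of norm `D`: the terms `D * γ` and `D / ε` serve the two diagonal entries.
  obtain ⟨c, hc, hblock⟩ : ∃ c : ℝ, 0 ≤ c ∧ ∀ n,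
      BlockNonneg ((c * q ^ n) • -(ℑ (h^[n] w₀) : B)) (h^[n] w₀ - h^[n + 1] w₀)
        ((c * q ^ n) • -(ℑ (h^[n + 1] w₀) : B)) := by
    obtain ⟨ε, hε, hε'⟩ := (hstep w₀ hw₀S).mem_opLowerHalf hη hγ
    set D := ‖w₀ - h w₀‖
    refine ⟨D * γ + D / ε, by positivity, fun n => ?_⟩
    induction n with
    | zero =>
      refine BlockNonneg.of_norm_le (c := D) le_rfl ?_ ?_
      · simp only [Function.iterate_zero, id, pow_zero, mul_one, hIw₀, smul_smul]
        refine smul_le_smul_of_nonneg_right ?_ zero_le_one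
        rw [add_mul, mul_assoc, mul_inv_cancel₀ hγ.ne', mul_one]
        exact le_add_of_nonneg_right (by positivity)
      · simp only [zero_add, Function.iterate_one, pow_zero, mul_one]
        refine le_trans ?_ (smul_le_smul_of_nonneg_left hε' (by positivity))
        rw [smul_smul]
        refine smul_le_smul_of_nonneg_right ?_ zero_le_one
        rw [add_mul, div_mul_cancel₀ _ hε.ne']
        exact le_add_of_nonneg_left (by positivity)
    | succ n ih =>
      have h1 := hstep _ (hS n)
      have h2 := hstep _ (hS (n + 1))
      have h3 := h1.blockNonneg h2 hη hγ le_rfl (by positivity) ih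
      rw [← Function.iterate_succ_apply' h, ← Function.iterate_succ_apply' h] at h3
      rw [← Function.iterate_succ_apply' h] at h1 h2
      convert h3 using 2
      · rw [pow_succ, mul_assoc]
      -- Resolvent identity: `g₁ η(w₁ - w₂) g₂ = g₁ - g₂` for two steps at the same `b`.
      · have : η (h^[n] w₀ - h^[n + 1] w₀)
            = (b - η (h^[n + 1] w₀)) - (b - η (h^[n] w₀)) := by
          rw [map_sub]; abel
        rw [this, mul_sub, sub_mul, h1.mul_left, one_mul, mul_assoc, h2.mul_right, mul_one]
      · rw [pow_succ, mul_assoc]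
  have hdist : ∀ n, dist (h^[n] w₀) (h^[n + 1] w₀) ≤ (c * γ⁻¹) * q ^ n := fun n => by
    rw [dist_eq_norm]
    refine ((hstep _ (hS n)).norm_le_of_blockNonneg (hstep _ (hS (n + 1))) hγ (by positivity)
      (hblock n)).trans_eq (by ring)
  obtain ⟨g, hg⟩ := cauchySeq_tendsto_of_complete (cauchySeq_of_le_geometric _ _ hq1 hdist)
  have hIm : Continuous fun w : B => -(ℑ w : B) := by
    simp only [imaginaryPart_apply_coe]
    fun_prop
  have hSclosed : IsClosed S :=
    (isClosed_le continuous_const hIm).inter (isClosed_le hIm continuous_const)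
  have hgS : g ∈ S := hSclosed.mem_of_tendsto hg (.of_forall hS)
  have hcont : ContinuousAt h g := by
    obtain ⟨u, hu⟩ := isUnit_of_le_imaginaryPart hγ (le_imaginaryPart_sub_map hη hb hgS.1)
    refine ContinuousAt.comp (f := fun w => b - η w) (g := Ring.inverse) ?_ (by fun_prop)
    rw [← hu]
    exact NormedRing.inverse_continuousAt u
  have hfix : h g = g := by
    refine tendsto_nhds_unique (hcont.tendsto.comp hg) ?_
    refine ((tendsto_add_atTop_iff_nat 1).mpr hg).congr fun n => ?_
    rw [Function.iterate_succ_apply']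
    rfl
  exact ⟨g, by simpa only [hfix] using hstep g hgS⟩

end Existence

end Step

/-! ### Stability operator and Lipschitz bounds -/

/-- The Neumann series converges although `‖s‖` itself may exceed `1`; its zeroth term contributes
`‖1‖`. -/
lemma isUnit_one_sub_of_norm_pow_le {R : Type*} [NormedRing R] [CompleteSpace R] {s : R}
    {c q : ℝ} (hq : 0 ≤ q) (hq' : q < 1) (h : ∀ n, ‖s ^ (n + 1)‖ ≤ c * q ^ n) :
    IsUnit (1 - s) ∧ ‖Ring.inverse (1 - s)‖ ≤ ‖(1 : R)‖ + c * (1 - q)⁻¹ := by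
  have hgeo : HasSum (fun n => c * q ^ n) (c * (1 - q)⁻¹) :=
    (hasSum_geometric_of_lt_one hq hq').mul_left c
  have hs1 : Summable fun n => s ^ (n + 1) := .of_norm_bounded hgeo.summable h
  have hs : Summable (s ^ ·) := (summable_nat_add_iff 1).mp hs1
  let u : Rˣ := ⟨1 - s, ∑' n, s ^ n, hs.one_sub_mul_tsum_pow, hs.tsum_pow_mul_one_sub⟩
  refine ⟨u.isUnit, ?_⟩
  rw [show 1 - s = (u : R) from rfl, Ring.inverse_unit]
  change ‖∑' n, s ^ n‖ ≤ _
  rw [hs.tsum_eq_zero_add, pow_zero]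
  exact (norm_add_le _ _).trans (by gcongr; exact tsum_of_norm_bounded hgeo h)

section Stability

variable {B : Type*} [CStarAlgebra B]

/-- The operator `x ↦ g₁ η(x) g₂`. -/
noncomputable def sandwich (η : B →L[ℂ] B) (g₁ g₂ : B) : B →L[ℂ] B :=
  (ContinuousLinearMap.mulLeftRight ℂ B g₁ g₂).comp η

@[simp]
lemma sandwich_apply (η : B →L[ℂ] B) (g₁ g₂ x : B) : sandwich η g₁ g₂ x = g₁ * η x * g₂ := rfl

/-- A bound for the inverse of the stability operator `1 - sandwich η g₁ g₂`. -/
noncomputable def stabilityBound (K γ : ℝ) : ℝ := 1 + K * γ⁻¹ * γ⁻¹ * (1 - dysonRate K γ)⁻¹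

lemma stabilityBound_nonneg {K γ : ℝ} (hγ : 0 < γ) (hK : 0 ≤ K) : 0 ≤ stabilityBound K γ := by
  have := sub_pos.mpr (dysonRate_lt_one hγ hK)
  unfold stabilityBound
  positivity

variable [PartialOrder B] {η : B →L[ℂ] B} {γ K : ℝ} {b g b₁ b₂ g₁ g₂ : B}

lemma IsDysonStep.sub_sub_sandwich (h₁ : IsDysonStep η γ b₁ g₁ g₁) (h₂ : IsDysonStep η γ b₂ g₂ g₂) :
    (g₁ - g₂) - sandwich η g₁ g₂ (g₁ - g₂) = g₁ * (b₂ - b₁) * g₂ := by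
  have h3 : b₂ - b₁ = (b₂ - η g₂) - (b₁ - η g₁) - η (g₁ - g₂) := by rw [map_sub]; abel
  rw [h3, mul_sub, sub_mul, mul_sub, sub_mul, h₁.mul_left, one_mul, mul_assoc g₁ (b₂ - η g₂),
    h₂.mul_right, mul_one, sandwich_apply]

variable [StarOrderedRing B]

namespace IsDysonStep

/-- The first application turns the norm bound `‖η x‖ ≤ K‖x‖` into a block bound, using `Im(b - η g)
≥ γ`. Each further one gains the rate, hence the exponents `n + 1` and `n`. -/
lemma norm_sandwich_pow_le (h₁ : IsDysonStep η γ b₁ g₁ g₁) (h₂ : IsDysonStep η γ b₂ g₂ g₂)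
    (hη : η ∈ kPositiveMaps 2 B) (hγ : 0 < γ) (hK : ‖η‖ ≤ K) (n : ℕ) :
    ‖sandwich η g₁ g₂ ^ (n + 1)‖ ≤ K * γ⁻¹ * γ⁻¹ * dysonRate K γ ^ n := by
  have hK0 : 0 ≤ K := (norm_nonneg η).trans hK
  have hq := dysonRate_nonneg hγ hK0
  have hblock : ∀ x : B,
      BlockNonneg ((K * ‖x‖ * γ⁻¹ * dysonRate K γ ^ n) • -(ℑ g₁ : B))
        ((sandwich η g₁ g₂ ^ (n + 1)) x)
        ((K * ‖x‖ * γ⁻¹ * dysonRate K γ ^ n) • -(ℑ g₂ : B)) := fun x => by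
    induction n with
    | zero =>
      have him : ∀ {b g : B}, IsDysonStep η γ b g g →
          (K * ‖x‖) • (1 : B) ≤ (K * ‖x‖ * γ⁻¹) • (ℑ (b - η g) : B) := fun h => by
        refine le_trans (le_of_eq ?_) (smul_le_smul_of_nonneg_left
          (le_imaginaryPart_sub_map hη h.le_imaginaryPart h.nonneg) (by positivity))
        rw [smul_smul]
        congr 1
        field_simp
      have hx : ‖η x‖ ≤ K * ‖x‖ := (η.le_opNorm x).trans (by gcongr)
      simpa only [pow_zero, mul_one, zero_add, pow_one, sandwich_apply, mul_smul_comm, smul_mul_assoc,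
        imaginaryPart_conj_left h₁.mul_left, imaginaryPart_conj_right h₂.mul_right]
        using (BlockNonneg.of_norm_le hx (him h₁) (him h₂)).conj g₁ g₂
    | succ n ih =>
      have h3 := h₁.blockNonneg h₂ hη hγ hK (by positivity) ih
      rw [mul_assoc _ _ (dysonRate K γ), ← pow_succ] at h3
      rw [pow_succ' (sandwich η g₁ g₂)]
      exact h3
  refine ContinuousLinearMap.opNorm_le_bound _ (by positivity) fun x => ?_
  refine (h₁.norm_le_of_blockNonneg h₂ hγ (by positivity) (hblock x)).trans_eq (by ring)

lemma isUnit_one_sub_sandwich (h₁ : IsDysonStep η γ b₁ g₁ g₁) (h₂ : IsDysonStep η γ b₂ g₂ g₂)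
    (hη : η ∈ kPositiveMaps 2 B) (hγ : 0 < γ) : IsUnit (1 - sandwich η g₁ g₂) :=
  (isUnit_one_sub_of_norm_pow_le (dysonRate_nonneg hγ (norm_nonneg η))
    (dysonRate_lt_one hγ (norm_nonneg η))
    (h₁.norm_sandwich_pow_le h₂ hη hγ le_rfl)).1

lemma norm_inverse_one_sub_sandwich_le (h₁ : IsDysonStep η γ b₁ g₁ g₁)
    (h₂ : IsDysonStep η γ b₂ g₂ g₂) (hη : η ∈ kPositiveMaps 2 B) (hγ : 0 < γ) (hK : ‖η‖ ≤ K) :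
    ‖Ring.inverse (1 - sandwich η g₁ g₂)‖ ≤ stabilityBound K γ := by
  have hK0 : 0 ≤ K := (norm_nonneg η).trans hK
  refine (isUnit_one_sub_of_norm_pow_le (dysonRate_nonneg hγ hK0) (dysonRate_lt_one hγ hK0)
    (h₁.norm_sandwich_pow_le h₂ hη hγ hK)).2.trans ?_
  unfold stabilityBound
  gcongr
  exact ContinuousLinearMap.norm_id_le

lemma inverse_apply_sub_sandwich (h₁ : IsDysonStep η γ b₁ g₁ g₁) (h₂ : IsDysonStep η γ b₂ g₂ g₂)
    (hη : η ∈ kPositiveMaps 2 B) (hγ : 0 < γ) (x : B) :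
    Ring.inverse (1 - sandwich η g₁ g₂) (x - sandwich η g₁ g₂ x) = x := by
  have h := Ring.inverse_mul_cancel _ (h₁.isUnit_one_sub_sandwich h₂ hη hγ)
  exact congrArg (fun T : B →L[ℂ] B => T x) h

lemma norm_sub_le (h₁ : IsDysonStep η γ b₁ g₁ g₁) (h₂ : IsDysonStep η γ b₂ g₂ g₂)
    (hη : η ∈ kPositiveMaps 2 B) (hγ : 0 < γ) (hK : ‖η‖ ≤ K) :
    ‖g₁ - g₂‖ ≤ stabilityBound K γ * γ⁻¹ * γ⁻¹ * ‖b₁ - b₂‖ := by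
  have hK0 : 0 ≤ K := (norm_nonneg η).trans hK
  have hC := stabilityBound_nonneg hγ hK0
  rw [← h₁.inverse_apply_sub_sandwich h₂ hη hγ (g₁ - g₂), h₁.sub_sub_sandwich h₂]
  calc _ ≤ ‖Ring.inverse (1 - sandwich η g₁ g₂)‖ * ‖g₁ * (b₂ - b₁) * g₂‖ :=
        ContinuousLinearMap.le_opNorm _ _
    _ ≤ stabilityBound K γ * (γ⁻¹ * ‖b₂ - b₁‖ * γ⁻¹) := by
        gcongr
        · exact h₁.norm_inverse_one_sub_sandwich_le h₂ hη hγ hK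
        · refine (norm_mul_le _ _).trans ?_
          gcongr
          · refine (norm_mul_le _ _).trans ?_
            gcongr
            exact h₁.norm_le hη hγ
          · exact h₂.norm_le hη hγ
    _ = _ := by rw [norm_sub_rev b₂]; ring

lemma unique (h₁ : IsDysonStep η γ b g₁ g₁) (h₂ : IsDysonStep η γ b g₂ g₂)
    (hη : η ∈ kPositiveMaps 2 B) (hγ : 0 < γ) : g₁ = g₂ := by
  have h := h₁.norm_sub_le h₂ hη hγ le_rfl
  rw [sub_self, norm_zero, mul_zero] at h
  exact sub_eq_zero.mp (norm_le_zero_iff.mp h)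

lemma of_mem_opLowerHalf (hη : η ∈ kPositiveMaps 2 B) (hγ : 0 < γ)
    (hb : γ • (1 : B) ≤ (ℑ b : B)) (hg : g ∈ opLowerHalf B) (h : b * g = 1 + η g * g) :
    IsDysonStep η γ b g g := by
  obtain ⟨ε, hε, hg⟩ := hg
  have hg0 : 0 ≤ -(ℑ g : B) := (smul_nonneg hε.le zero_le_one).trans hg
  have him := le_imaginaryPart_sub_map hη hb hg0
  have hr : (b - η g) * g = 1 := by rw [sub_mul, h, add_sub_cancel_right]
  have hl : g * (b - η g) = 1 := by
    obtain ⟨u, hu⟩ := isUnit_of_le_imaginaryPart hγ him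
    rw [← hu] at hr ⊢
    rw [← Units.mul_eq_one_iff_inv_eq.mp hr, Units.inv_mul]
  exact ⟨hb, hg0, neg_imaginaryPart_le (norm_le_inv_of_le_imaginaryPart hγ him hr), hr, hl⟩

/-- A solution for `η₂` at `b` solves the equation for `η₁` at a point close to `b`. -/
lemma change_map {η₁ η₂ : B →L[ℂ] B} (hη₂ : η₂ ∈ kPositiveMaps 2 B) (hγ : 0 < γ)
    (h : IsDysonStep η₂ γ b g g) (hd : ‖η₁ - η₂‖ ≤ γ ^ 2 / 2) :
    IsDysonStep η₁ (γ / 2) (b + (η₁ - η₂) g) g g := by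
  have hsub : b + (η₁ - η₂) g - η₁ g = b - η₂ g := by
    rw [sub_apply]; abel
  refine ⟨?_, h.nonneg, h.le.trans ?_, by rw [hsub, h.mul_right], by rw [hsub, h.mul_left]⟩
  -- As `‖g‖ ≤ γ⁻¹`, the base point moves by at most `γ / 2`, which leaves half of the lower bound
  -- on `Im b`.
  · have hn : ‖(η₁ - η₂) g‖ ≤ γ / 2 := by
      calc _ ≤ ‖η₁ - η₂‖ * ‖g‖ := ContinuousLinearMap.le_opNorm _ _
        _ ≤ γ ^ 2 / 2 * γ⁻¹ := by
            gcongr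
            exact h.norm_le hη₂ hγ
        _ = γ / 2 := by field_simp
    have h1 := add_le_add h.le_imaginaryPart (neg_le_neg (neg_imaginaryPart_le hn))
    rw [neg_neg, ← sub_eq_add_neg, ← sub_smul, sub_half] at h1
    rwa [map_add, AddSubgroup.coe_add]
  · refine smul_le_smul_of_nonneg_right ?_ zero_le_one
    gcongr
    linarith

lemma norm_sub_le_of_ne_map {η₁ η₂ : B →L[ℂ] B} (hη₁ : η₁ ∈ kPositiveMaps 2 B)
    (hη₂ : η₂ ∈ kPositiveMaps 2 B) (hγ : 0 < γ)
    (h₁ : IsDysonStep η₁ γ b₁ g₁ g₁) (h₂ : IsDysonStep η₂ γ b₂ g₂ g₂) (hK : ‖η₁‖ ≤ K)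
    (hd : ‖η₁ - η₂‖ ≤ γ ^ 2 / 2) :
    ‖g₁ - g₂‖ ≤ stabilityBound K (γ / 2) * (γ / 2)⁻¹ * (γ / 2)⁻¹ * (1 + γ⁻¹) *
      (‖η₁ - η₂‖ + ‖b₁ - b₂‖) := by
  have hγ2 : 0 < γ / 2 := by positivity
  have hK0 : 0 ≤ K := (norm_nonneg η₁).trans hK
  have hC := stabilityBound_nonneg hγ2 hK0
  -- Replacing `η₁` by itself moves nothing and only relaxes `γ` to `γ / 2`.
  have h₁' : IsDysonStep η₁ (γ / 2) b₁ g₁ g₁ := by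
    simpa using change_map (η₁ := η₁) hη₁ hγ h₁ (by simp; positivity)
  refine (h₁'.norm_sub_le (change_map hη₂ hγ h₂ hd) hη₁ hγ2 hK).trans ?_
  rw [mul_assoc _ (1 + γ⁻¹)]
  gcongr
  calc ‖b₁ - (b₂ + (η₁ - η₂) g₂)‖ ≤ ‖b₁ - b₂‖ + ‖(η₁ - η₂) g₂‖ := by
        rw [← sub_sub]; exact _root_.norm_sub_le _ _
    _ ≤ ‖b₁ - b₂‖ + ‖η₁ - η₂‖ * γ⁻¹ := by
        gcongr
        refine (ContinuousLinearMap.le_opNorm _ _).trans ?_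
        gcongr
        exact h₂.norm_le hη₂ hγ
    _ ≤ (1 + γ⁻¹) * (‖η₁ - η₂‖ + ‖b₁ - b₂‖) := by
        have : 0 ≤ γ⁻¹ := by positivity
        nlinarith [norm_nonneg (η₁ - η₂), norm_nonneg (b₁ - b₂),
          mul_nonneg this (norm_nonneg (b₁ - b₂))]

end IsDysonStep

/-! ### The solution is well defined -/

lemma exists_isDysonSolution (hη : η ∈ kPositiveMaps 2 B) : ∃ F : B → B, IsDysonSolution η F := by
  have h : ∀ b : B, ∃ g : B, b ∈ opUpperHalf B → g ∈ opLowerHalf B ∧ b * g = 1 + η g * g := by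
    intro b
    by_cases hb : b ∈ opUpperHalf B
    · obtain ⟨γ, hγ, hb⟩ := hb
      obtain ⟨g, hg⟩ := exists_isDysonStep_self hη hγ hb
      refine ⟨g, fun _ => ⟨hg.mem_opLowerHalf hη hγ, ?_⟩⟩
      rw [← hg.mul_right]
      noncomm_ring
    · exact ⟨0, fun h => absurd h hb⟩
  choose F hF using h
  exact ⟨F, hF⟩

lemma isDysonSolution_dysonSolution (hη : η ∈ kPositiveMaps 2 B) :
    IsDysonSolution η (dysonSolution η) := by
  rw [dysonSolution, dif_pos (exists_isDysonSolution hη)]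
  exact (exists_isDysonSolution hη).choose_spec

lemma IsDysonSolution.isDysonStep {F : B → B} (hF : IsDysonSolution η F)
    (hη : η ∈ kPositiveMaps 2 B) (hγ : 0 < γ) (hb : b ∈ opClosedUpperHalf B γ) :
    IsDysonStep η γ b (F b) (F b) :=
  .of_mem_opLowerHalf hη hγ hb (hF b ⟨γ, hγ, hb⟩).1 (hF b ⟨γ, hγ, hb⟩).2

lemma IsDysonSolution.eqOn {F₁ F₂ : B → B} (h₁ : IsDysonSolution η F₁) (h₂ : IsDysonSolution η F₂)
    (hη : η ∈ kPositiveMaps 2 B) : Set.EqOn F₁ F₂ (opUpperHalf B) := by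
  rintro b ⟨γ, hγ, hb⟩
  exact (h₁.isDysonStep hη hγ hb).unique (h₂.isDysonStep hη hγ hb) hη hγ

/-! ### The Fréchet derivative -/

lemma eventually_mem_opClosedUpperHalf {b : B} {γ γ' : ℝ} (hb : b ∈ opClosedUpperHalf B γ)
    (h : γ' < γ) : ∀ᶠ x in 𝓝 b, x ∈ opClosedUpperHalf B γ' := by
  filter_upwards [Metric.ball_mem_nhds b (sub_pos.mpr h)] with x hx
  have h1 : ‖x - b‖ ≤ γ - γ' := (mem_ball_iff_norm.mp hx).le
  have h2 := add_le_add (show γ • (1 : B) ≤ (ℑ b : B) from hb)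
    (neg_le_neg (neg_imaginaryPart_le h1))
  rw [neg_neg, ← sub_eq_add_neg, ← sub_smul, sub_sub_cancel, ← AddSubgroup.coe_add, ← map_add,
    add_sub_cancel] at h2
  exact h2

/-- The derivative of the solution of the Dyson equation, as a function of the solution. -/
noncomputable def dysonDeriv (η : B →L[ℂ] B) (g : B) : B →L[ℂ] B :=
  -(Ring.inverse (1 - sandwich η g g) * ContinuousLinearMap.mulLeftRight ℂ B g g)

/-- With `δ = G x - G b`, the remainder is exactly `(1 - S)⁻¹ (δ (b - x + η δ) G b)`. It is
quadratic in `‖x - b‖`, since `δ` is Lipschitz-small. -/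
lemma hasFDerivAt_dysonSolution (hη : η ∈ kPositiveMaps 2 B) (hb : b ∈ opUpperHalf B) :
    HasFDerivAt (dysonSolution η) (dysonDeriv η (dysonSolution η b)) b := by
  obtain ⟨ε, hε, hb⟩ := hb
  set G := dysonSolution η
  set γ := ε / 2
  have hγ : 0 < γ := by positivity
  have hnear := eventually_mem_opClosedUpperHalf hb (half_lt_self hε)
  have hpt : ∀ {x}, x ∈ opClosedUpperHalf B γ → IsDysonStep η γ x (G x) (G x) := fun hx =>
    (isDysonSolution_dysonSolution hη).isDysonStep hη hγ hx
  have hb' := hpt hnear.self_of_nhds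
  set R := Ring.inverse (1 - sandwich η (G b) (G b)) with hR
  set L := stabilityBound ‖η‖ γ * γ⁻¹ * γ⁻¹
  have hL : 0 ≤ L := by
    have := stabilityBound_nonneg hγ (norm_nonneg η)
    positivity
  have hrem : (fun x => G x - G b - dysonDeriv η (G b) (x - b)) =O[𝓝 b]
      fun x => ‖x - b‖ ^ 2 := by
    refine Asymptotics.IsBigO.of_bound (‖R‖ * (L * (1 + ‖η‖ * L) * γ⁻¹)) ?_
    filter_upwards [hnear] with x hx
    have hx' := hpt hx
    have hd : ‖G x - G b‖ ≤ L * ‖x - b‖ := hx'.norm_sub_le hb' hη hγ le_rfl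
    have heq : G x - G b - dysonDeriv η (G b) (x - b)
        = R ((G x - G b) * (b - x + η (G x - G b)) * G b) := by
      have h1 := hb'.inverse_apply_sub_sandwich hb' hη hγ (G x - G b)
      have h2 : dysonDeriv η (G b) (x - b) = R (-(G b * (x - b) * G b)) := by
        rw [map_neg]; rfl
      rw [h2]
      nth_rw 1 [← h1]
      rw [← hR, ← map_sub]
      congr 1
      have h3 := hx'.sub_sub_sandwich hb'
      rw [sandwich_apply] at h3 ⊢
      rw [sub_eq_iff_eq_add] at h3
      nth_rw 1 [h3]
      noncomm_ring
    rw [heq, Real.norm_of_nonneg (by positivity)]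
    calc _ ≤ ‖R‖ * ‖(G x - G b) * (b - x + η (G x - G b)) * G b‖ := R.le_opNorm _
      _ ≤ ‖R‖ * ((L * ‖x - b‖) * (‖x - b‖ + ‖η‖ * (L * ‖x - b‖)) * γ⁻¹) := by
          gcongr
          refine (norm_mul_le _ _).trans ?_
          gcongr
          · refine (norm_mul_le _ _).trans ?_
            gcongr
            refine (norm_add_le _ _).trans ?_
            rw [norm_sub_rev b x]
            gcongr
            exact (η.le_opNorm _).trans (by gcongr)
          · exact hb'.norm_le hη hγ
      _ = _ := by ring
  rw [hasFDerivAt_iff_isLittleO]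
  refine hrem.trans_isLittleO ?_
  have h0 : Tendsto (fun x => x - b) (𝓝 b) (𝓝 0) :=
    (continuous_sub_right b).tendsto' b 0 (sub_self b)
  exact ((Asymptotics.isLittleO_pow_id one_lt_two).comp_tendsto
    (tendsto_norm_zero.comp h0)).norm_right.congr_right (by simp) |>.of_norm_right

/-- The two inverses are compared by the resolvent identity, and the products `g · g` by
telescoping. -/
lemma norm_dysonDeriv_sub_le {η₁ η₂ : B →L[ℂ] B} (hη₁ : η₁ ∈ kPositiveMaps 2 B)
    (hη₂ : η₂ ∈ kPositiveMaps 2 B) (hγ : 0 < γ)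
    (h₁ : IsDysonStep η₁ γ b₁ g₁ g₁) (h₂ : IsDysonStep η₂ γ b₂ g₂ g₂) (hK₁ : ‖η₁‖ ≤ K)
    (hK₂ : ‖η₂‖ ≤ K) :
    ‖dysonDeriv η₁ g₁ - dysonDeriv η₂ g₂‖ ≤
      stabilityBound K γ * (2 * γ⁻¹ * ‖g₁ - g₂‖) +
      stabilityBound K γ * (2 * γ⁻¹ * ‖g₁ - g₂‖ * K + γ⁻¹ * γ⁻¹ * ‖η₁ - η₂‖) *
        stabilityBound K γ * (γ⁻¹ * γ⁻¹) := by
  have hK0 : 0 ≤ K := (norm_nonneg η₁).trans hK₁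
  have hC := stabilityBound_nonneg hγ hK0
  set C := stabilityBound K γ
  set M₁ := ContinuousLinearMap.mulLeftRight ℂ B g₁ g₁ with hM₁
  set M₂ := ContinuousLinearMap.mulLeftRight ℂ B g₂ g₂ with hM₂
  set S₁ := sandwich η₁ g₁ g₁ with hS₁
  set S₂ := sandwich η₂ g₂ g₂ with hS₂
  have hg₁ := h₁.norm_le hη₁ hγ
  have hg₂ := h₂.norm_le hη₂ hγ
  have hMn : ‖M₂‖ ≤ γ⁻¹ * γ⁻¹ :=
    (ContinuousLinearMap.opNorm_mulLeftRight_apply_apply_le ℂ B g₂ g₂).trans (by gcongr)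
  have hM : ‖M₁ - M₂‖ ≤ 2 * γ⁻¹ * ‖g₁ - g₂‖ := by
    have : M₁ - M₂ = ContinuousLinearMap.mulLeftRight ℂ B (g₁ - g₂) g₁
        + ContinuousLinearMap.mulLeftRight ℂ B g₂ (g₁ - g₂) := by
      ext x
      simp only [hM₁, hM₂, sub_apply, add_apply,
        ContinuousLinearMap.mulLeftRight_apply]
      noncomm_ring
    rw [this]
    calc _ ≤ ‖g₁ - g₂‖ * ‖g₁‖ + ‖g₂‖ * ‖g₁ - g₂‖ :=
          (norm_add_le _ _).trans (add_le_add
            (ContinuousLinearMap.opNorm_mulLeftRight_apply_apply_le ℂ B _ _)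
            (ContinuousLinearMap.opNorm_mulLeftRight_apply_apply_le ℂ B _ _))
      _ ≤ ‖g₁ - g₂‖ * γ⁻¹ + γ⁻¹ * ‖g₁ - g₂‖ := by gcongr
      _ = _ := by ring
  have hS : ‖S₁ - S₂‖ ≤ 2 * γ⁻¹ * ‖g₁ - g₂‖ * K + γ⁻¹ * γ⁻¹ * ‖η₁ - η₂‖ := by
    have : S₁ - S₂ = (M₁ - M₂) * η₁ + M₂ * (η₁ - η₂) := by
      rw [sub_mul, mul_sub, sub_add_sub_cancel]; rfl
    rw [this]
    refine (norm_add_le _ _).trans (add_le_add ((norm_mul_le _ _).trans ?_)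
      ((norm_mul_le _ _).trans ?_)) <;> gcongr
  have hu₁ := h₁.isUnit_one_sub_sandwich h₁ hη₁ hγ
  have hu₂ := h₂.isUnit_one_sub_sandwich h₂ hη₂ hγ
  have hR₁ := h₁.norm_inverse_one_sub_sandwich_le h₁ hη₁ hγ hK₁
  have hR₂ := h₂.norm_inverse_one_sub_sandwich_le h₂ hη₂ hγ hK₂
  have hR : Ring.inverse (1 - S₁) - Ring.inverse (1 - S₂)
      = Ring.inverse (1 - S₁) * (S₁ - S₂) * Ring.inverse (1 - S₂) := by
    rw [Ring.inverse_sub_inverse (iff_of_true hu₁ hu₂), sub_sub_sub_cancel_left]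
  have hD : dysonDeriv η₁ g₁ - dysonDeriv η₂ g₂
      = -(Ring.inverse (1 - S₁) * (M₁ - M₂)
        + Ring.inverse (1 - S₁) * (S₁ - S₂) * Ring.inverse (1 - S₂) * M₂) := by
    rw [← hR]
    change -(Ring.inverse (1 - S₁) * M₁) - -(Ring.inverse (1 - S₂) * M₂) = _
    rw [sub_mul, mul_sub]
    abel
  rw [hD, norm_neg]
  refine (norm_add_le _ _).trans (add_le_add ((norm_mul_le _ _).trans (by gcongr))
    ((norm_mul_le _ _).trans ?_))
  gcongr
  refine (norm_mul_le _ _).trans ?_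
  gcongr
  refine (norm_mul_le _ _).trans ?_
  gcongr

end Stability

/-! ### From local Lipschitz bounds to equicontinuity -/

section Continuity

variable {B : Type*} [CStarAlgebra B] [PartialOrder B] [StarOrderedRing B]
  {E : Type*} [NormedAddCommGroup E]

/-- A family `F η b` that is jointly Lipschitz for nearby maps `η` of bounded norm and all `b` with
`Im b ≥ γ`, for every `γ > 0`. -/
def LocallyLipschitzOnUpperHalf (F : (B →L[ℂ] B) → B → E) : Prop :=
  ∀ γ : ℝ, 0 < γ → ∀ K : ℝ, ∃ L r : ℝ, 0 ≤ L ∧ 0 < r ∧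
    ∀ η₁ ∈ kPositiveMaps 2 B, ∀ η₂ ∈ kPositiveMaps 2 B, ‖η₁‖ ≤ K → ‖η₂‖ ≤ K → ‖η₁ - η₂‖ ≤ r →
      ∀ b₁ ∈ opClosedUpperHalf B γ, ∀ b₂ ∈ opClosedUpperHalf B γ,
        ‖F η₁ b₁ - F η₂ b₂‖ ≤ L * (‖η₁ - η₂‖ + ‖b₁ - b₂‖)

namespace LocallyLipschitzOnUpperHalf

variable {F : (B →L[ℂ] B) → B → E}

lemma eventually_le (hF : LocallyLipschitzOnUpperHalf F) {γ : ℝ} (hγ : 0 < γ)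
    (η₀ : kPositiveMaps 2 B) : ∃ L : ℝ, 0 ≤ L ∧ ∀ᶠ η : kPositiveMaps 2 B in 𝓝 η₀,
      ∀ b₁ ∈ opClosedUpperHalf B γ, ∀ b₂ ∈ opClosedUpperHalf B γ,
        ‖F η b₁ - F η₀ b₂‖ ≤ L * (‖(η : B →L[ℂ] B) - η₀‖ + ‖b₁ - b₂‖) := by
  obtain ⟨L, r, hL, hr, h⟩ := hF γ hγ (‖(η₀ : B →L[ℂ] B)‖ + 1)
  refine ⟨L, hL, ?_⟩
  -- Radius at most `1` keeps `‖η‖ ≤ ‖η₀‖ + 1`, the norm bound for which `L` and `r` were chosen.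
  filter_upwards [Metric.ball_mem_nhds η₀ (lt_min hr one_pos)] with η hη
  rw [Metric.mem_ball, Subtype.dist_eq, dist_eq_norm, lt_min_iff] at hη
  refine h η η.2 η₀ η₀.2 ?_ (by linarith) hη.1.le
  calc ‖(η : B →L[ℂ] B)‖ = ‖(η₀ : B →L[ℂ] B) + (η - η₀)‖ := by rw [add_sub_cancel]
    _ ≤ _ := (norm_add_le _ _).trans (by gcongr; exact hη.2.le)

lemma tendsto_norm_sub (η₀ : kPositiveMaps 2 B) (L : ℝ) :
    Tendsto (fun η : kPositiveMaps 2 B => L * ‖(η : B →L[ℂ] B) - η₀‖) (𝓝 η₀) (𝓝 0) := by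
  have : Continuous fun η : kPositiveMaps 2 B => L * ‖(η : B →L[ℂ] B) - η₀‖ := by fun_prop
  exact this.tendsto' _ _ (by simp)

lemma equicontinuous (hF : LocallyLipschitzOnUpperHalf F) {γ : ℝ} (hγ : 0 < γ) :
    Equicontinuous (fun (b : opClosedUpperHalf B γ) (η : kPositiveMaps 2 B) =>
      F (η : B →L[ℂ] B) (b : B)) := by
  intro η₀
  obtain ⟨L, -, h⟩ := hF.eventually_le hγ η₀
  refine Metric.equicontinuousAt_of_continuity_modulus _ (tendsto_norm_sub η₀ L) _ ?_
  filter_upwards [h] with η hη b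
  rw [dist_comm, dist_eq_norm]
  simpa using hη b b.2 b b.2

/-- The supremum lives in `[0, ∞]`, so it is meaningful without prior boundedness. -/
lemma tendsto_iSup (hF : LocallyLipschitzOnUpperHalf F) {γ : ℝ} (hγ : 0 < γ)
    (η₀ : kPositiveMaps 2 B) :
    Tendsto (fun η : kPositiveMaps 2 B => ⨆ b ∈ opClosedUpperHalf B γ,
      ‖F (η : B →L[ℂ] B) b - F (η₀ : B →L[ℂ] B) b‖ₑ) (𝓝 η₀) (𝓝 0) := by
  obtain ⟨L, -, h⟩ := hF.eventually_le hγ η₀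
  have h0 := ENNReal.tendsto_ofReal (tendsto_norm_sub η₀ L)
  rw [ENNReal.ofReal_zero] at h0
  refine tendsto_of_tendsto_of_tendsto_of_le_of_le' tendsto_const_nhds h0
    (.of_forall fun _ => zero_le) ?_
  filter_upwards [h] with η hη
  refine iSup₂_le fun b hb => ?_
  rw [← ofReal_norm]
  exact ENNReal.ofReal_le_ofReal (by simpa using hη b hb b hb)

lemma continuous (hF : LocallyLipschitzOnUpperHalf F) :
    Continuous (fun p : kPositiveMaps 2 B × opUpperHalf B => F (p.1 : B →L[ℂ] B) (p.2 : B)) := by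
  rw [continuous_iff_continuousAt]
  rintro ⟨η₀, b₀, ε, hε, hb₀⟩
  have hnear := eventually_mem_opClosedUpperHalf hb₀ (half_lt_self hε)
  obtain ⟨L, -, h⟩ := hF.eventually_le (half_pos hε) η₀
  have hlim : Tendsto (fun p : kPositiveMaps 2 B × opUpperHalf B =>
      L * (‖(p.1 : B →L[ℂ] B) - η₀‖ + ‖(p.2 : B) - b₀‖)) (𝓝 (η₀, ⟨b₀, ε, hε, hb₀⟩)) (𝓝 0) := by
    have : Continuous fun p : kPositiveMaps 2 B × opUpperHalf B =>
        L * (‖(p.1 : B →L[ℂ] B) - η₀‖ + ‖(p.2 : B) - b₀‖) := by fun_prop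
    exact this.tendsto' _ _ (by simp)
  rw [ContinuousAt, tendsto_iff_norm_sub_tendsto_zero]
  refine squeeze_zero' (.of_forall fun _ => norm_nonneg _) ?_ hlim
  filter_upwards [continuous_fst.continuousAt.eventually h,
    (continuous_subtype_val.comp continuous_snd).continuousAt.eventually hnear] with p hp hp'
  exact hp _ hp' _ hnear.self_of_nhds

end LocallyLipschitzOnUpperHalf

lemma locallyLipschitzOnUpperHalf_dysonSolution :
    LocallyLipschitzOnUpperHalf (B := B) dysonSolution := by
  intro γ hγ K
  -- For `K < 0` no `η` satisfies `‖η‖ ≤ K`, so any constants do.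
  rcases lt_or_ge K 0 with hK | hK
  · exact ⟨0, 1, le_rfl, one_pos, fun η₁ _ _ _ h => absurd (norm_nonneg η₁) (by linarith)⟩
  refine ⟨_, γ ^ 2 / 2, ?_, by positivity, fun η₁ hη₁ η₂ hη₂ hK₁ hK₂ hd b₁ hb₁ b₂ hb₂ =>
    ((isDysonSolution_dysonSolution hη₁).isDysonStep hη₁ hγ hb₁).norm_sub_le_of_ne_map hη₁ hη₂ hγ
      ((isDysonSolution_dysonSolution hη₂).isDysonStep hη₂ hγ hb₂) hK₁ hd⟩
  have := stabilityBound_nonneg (half_pos hγ) hK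
  positivity

lemma locallyLipschitzOnUpperHalf_fderiv_dysonSolution :
    LocallyLipschitzOnUpperHalf (B := B) fun η => fderiv ℂ (dysonSolution η) := by
  intro γ hγ K
  rcases lt_or_ge K 0 with hK | hK
  · exact ⟨0, 1, le_rfl, one_pos, fun η₁ _ _ _ h => absurd (norm_nonneg η₁) (by linarith)⟩
  obtain ⟨L, r, hL, hr, h⟩ := locallyLipschitzOnUpperHalf_dysonSolution (B := B) γ hγ K
  have hC := stabilityBound_nonneg hγ hK
  set C := stabilityBound K γ with hC'
  refine ⟨C * (2 * γ⁻¹ * L) + C * (2 * γ⁻¹ * L * K + γ⁻¹ * γ⁻¹) * C * (γ⁻¹ * γ⁻¹), r,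
    by positivity, hr, fun η₁ hη₁ η₂ hη₂ hK₁ hK₂ hd b₁ hb₁ b₂ hb₂ => ?_⟩
  beta_reduce
  rw [(hasFDerivAt_dysonSolution hη₁ ⟨γ, hγ, hb₁⟩).fderiv,
    (hasFDerivAt_dysonSolution hη₂ ⟨γ, hγ, hb₂⟩).fderiv]
  have hG := h η₁ hη₁ η₂ hη₂ hK₁ hK₂ hd b₁ hb₁ b₂ hb₂
  refine (norm_dysonDeriv_sub_le hη₁ hη₂ hγ
    ((isDysonSolution_dysonSolution hη₁).isDysonStep hη₁ hγ hb₁)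
    ((isDysonSolution_dysonSolution hη₂).isDysonStep hη₂ hγ hb₂) hK₁ hK₂).trans ?_
  have hη : ‖η₁ - η₂‖ ≤ ‖η₁ - η₂‖ + ‖b₁ - b₂‖ := le_add_of_nonneg_right (norm_nonneg _)
  rw [← hC']
  set s := ‖η₁ - η₂‖ + ‖b₁ - b₂‖
  calc _ ≤ C * (2 * γ⁻¹ * (L * s)) +
        C * (2 * γ⁻¹ * (L * s) * K + γ⁻¹ * γ⁻¹ * s) * C * (γ⁻¹ * γ⁻¹) := by gcongr
    _ = _ := by ring

end Continuity

theorem theorem1p2 {B : Type*} [CStarAlgebra B] [PartialOrder B] [StarOrderedRing B] :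
    -- `G_η` is well defined and Fréchet differentiable on the upper half-plane
    (∀ η ∈ kPositiveMaps 2 B,
      IsDysonSolution η (dysonSolution η) ∧
      (∀ F : B → B, IsDysonSolution η F → Set.EqOn F (dysonSolution η) (opUpperHalf B)) ∧
      (∀ b ∈ opUpperHalf B, DifferentiableAt ℂ (dysonSolution η) b)) ∧
    -- equicontinuity and joint continuity of `G`
    (∀ γ : ℝ, 0 < γ →
      Equicontinuous (fun (b : opClosedUpperHalf B γ) (η : kPositiveMaps 2 B) =>
        dysonSolution (η : B →L[ℂ] B) (b : B)) ∧
      ∀ η₀ : kPositiveMaps 2 B,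
        Tendsto (fun η : kPositiveMaps 2 B => ⨆ b ∈ opClosedUpperHalf B γ,
          ‖dysonSolution (η : B →L[ℂ] B) b - dysonSolution (η₀ : B →L[ℂ] B) b‖ₑ) (𝓝 η₀) (𝓝 0)) ∧
    Continuous (fun p : kPositiveMaps 2 B × opUpperHalf B =>
      dysonSolution (p.1 : B →L[ℂ] B) (p.2 : B)) ∧
    -- equicontinuity and joint continuity of `DG`
    (∀ γ : ℝ, 0 < γ →
      Equicontinuous (fun (b : opClosedUpperHalf B γ) (η : kPositiveMaps 2 B) =>
        fderiv ℂ (dysonSolution (η : B →L[ℂ] B)) (b : B)) ∧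
      ∀ η₀ : kPositiveMaps 2 B,
        Tendsto (fun η : kPositiveMaps 2 B => ⨆ b ∈ opClosedUpperHalf B γ,
          ‖fderiv ℂ (dysonSolution (η : B →L[ℂ] B)) b -
            fderiv ℂ (dysonSolution (η₀ : B →L[ℂ] B)) b‖ₑ) (𝓝 η₀) (𝓝 0)) ∧
    Continuous (fun p : kPositiveMaps 2 B × opUpperHalf B =>
      fderiv ℂ (dysonSolution (p.1 : B →L[ℂ] B)) (p.2 : B)) := by
  have hG := locallyLipschitzOnUpperHalf_dysonSolution (B := B)
  have hD := locallyLipschitzOnUpperHalf_fderiv_dysonSolution (B := B)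
  refine ⟨fun η hη => ⟨isDysonSolution_dysonSolution hη, fun F hF =>
    hF.eqOn (isDysonSolution_dysonSolution hη) hη, fun b hb =>
    (hasFDerivAt_dysonSolution hη hb).differentiableAt⟩,
    fun γ hγ => ⟨hG.equicontinuous hγ, hG.tendsto_iSup hγ⟩, hG.continuous,
    fun γ hγ => ⟨hD.equicontinuous hγ, hD.tendsto_iSup hγ⟩, hD.continuous⟩
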